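/- Let $(M,h)$ be a closed Riemannian spin surface with a fixed orientation and spin structure, let $(N,g)$ be a Riemannian manifold, $B$ a smooth two-form on $N$, $\phi\colon M\to N$ a smooth map and $\psi$ a smooth section of $\Sigma M\otimes\phi^{-1}TN$, where $\Sigma M$ is the spinor bundle. Let $\slashed{D}\psi=\sum_\alpha e_\alpha\cdot\tilde\nabla_{e_\alpha}\psi$ be the twisted Dirac operator, where $\tilde\nabla$ is induced by the spin connection of $(M,h)$ and the Levi-Civita connection of $(N,g)$, $\{e_\alpha\}$ is a local orthonormal frame and $\cdot$ is Clifford multiplication, and put $$E_B(\phi,\psi)=\frac12\int_M\big(|d\phi|^2+\langle\psi,\slashed{D}\psi\rangle\big)\,d\mathrm{vol}_h+\int_M\phi^*B .$$ Then $E_B$ is invariant under conformal changes of the metric on $M$, and so is each of its three terms. Precisely: let $u\colon M\to\mathbb{R}$ be smooth, $\tilde h=e^{2u}h$, equip $(M,\tilde h)$ with the orientation and spin structure corresponding to those of $(M,h)$ (orthonormal frames being rescaled by $e^{-u}$), identify the spinor bundles of $(M,h)$ and $(M,\tilde h)$ isometrically through the corresponding spin frames, and set $\tilde\psi=e^{-u/2}\psi$.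 Then the three integrals $$\int_M|d\phi|^2\,d\mathrm{vol}_h,\qquad \int_M\langle\psi,\slashed{D}\psi\rangle\,d\mathrm{vol}_h,\qquad \int_M\phi^*B=\int_M(\phi^*B)(e_1,e_2)\,d\mathrm{vol}_h$$ (with $(e_1,e_2)$ an oriented orthonormal frame) and hence $E_B(\phi,\psi)$ have the same values for $(h,\phi,\psi)$ as for $(\tilde h,\phi,\tilde\psi)$, all metric-dependent objects on $M$ being formed with $h$, respectively $\tilde h$. -/

import Mathlib

open scoped Manifold ContDiff Bundle Topology
open MeasureTheory

noncomputable section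

namespace MagneticDirac

/-! ### Riemannian metrics, coordinates, volume -/

/-- Smooth Riemannian metrics on a boundaryless `n`-dimensional smooth manifold. -/
abbrev Metric (n : ℕ) (M : Type*) [TopologicalSpace M]
    [ChartedSpace (EuclideanSpace ℝ (Fin n)) M] [IsManifold (𝓡 n) ∞ M] :=
  Bundle.ContMDiffRiemannianMetric (𝓡 n) ∞ (EuclideanSpace ℝ (Fin n))
    (fun x : M => TangentSpace (𝓡 n) x)

/-- A smooth two-form on `N`: a smooth field of skew-symmetric bilinear forms. -/
structure TwoForm (n : ℕ) (N : Type*) [TopologicalSpace N]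
    [ChartedSpace (EuclideanSpace ℝ (Fin n)) N] [IsManifold (𝓡 n) ∞ N] where
  form (y : N) : TangentSpace (𝓡 n) y →L[ℝ] TangentSpace (𝓡 n) y →L[ℝ] ℝ
  skew (y : N) (v w : TangentSpace (𝓡 n) y) : form y v w = - form y w v
  contMDiff : ContMDiff (𝓡 n)
    ((𝓡 n).prod 𝓘(ℝ, EuclideanSpace ℝ (Fin n) →L[ℝ] EuclideanSpace ℝ (Fin n) →L[ℝ] ℝ)) ∞
    (fun y : N => Bundle.TotalSpace.mk'
      (EuclideanSpace ℝ (Fin n) →L[ℝ] EuclideanSpace ℝ (Fin n) →L[ℝ] ℝ)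
      (E := fun y : N => TangentSpace (𝓡 n) y →L[ℝ] TangentSpace (𝓡 n) y →L[ℝ] ℝ) y (form y))

section Coordinates

variable {n : ℕ} {M : Type*} [TopologicalSpace M]
  [ChartedSpace (EuclideanSpace ℝ (Fin n)) M] [IsManifold (𝓡 n) ∞ M]

/-- The coordinate vector `∂_k` at `x` of the chart around `c` (for `x` in its domain). -/
def coordVec (c x : M) (k : Fin n) : TangentSpace (𝓡 n) x :=
  (trivializationAt (EuclideanSpace ℝ (Fin n)) (fun x : M => TangentSpace (𝓡 n) x) c).symmL ℝ x
    (EuclideanSpace.single k 1)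

/-- The coordinate matrix `h_{ij}` of the metric at `x` in the chart around `c`. -/
def gram (h : Metric n M) (c x : M) : Matrix (Fin n) (Fin n) ℝ :=
  fun i j => h.inner x (coordVec c x i) (coordVec c x j)

/-- The coordinate derivative `∂_i h_{jl}` at the centre `c` of the chart around `c`. -/
def gramDeriv (h : Metric n M) (c : M) (i j l : Fin n) : ℝ :=
  fderiv ℝ (fun p => gram h c ((extChartAt (𝓡 n) c).symm p) j l) (extChartAt (𝓡 n) c c)
    (EuclideanSpace.single i 1)

/-- The Christoffel symbol `Γ^k_{ij}` of the Levi-Civita connection, in the chart around `c`,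
at the point `c`. -/
def christoffel (h : Metric n M) (c : M) (k i j : Fin n) : ℝ :=
  (1 / 2) * ∑ l, (gram h c c)⁻¹ k l *
    (gramDeriv h c i j l + gramDeriv h c j i l - gramDeriv h c l i j)

/-- The vector with components `Γ^k_{ij} v^i w^j` at `c`. Recall that `TangentSpace (𝓡 n) c` is
by definition the model space, through the chart around `c`. -/
def christoffelVec (h : Metric n M) (c : M) (v w : EuclideanSpace ℝ (Fin n)) :
    EuclideanSpace ℝ (Fin n) :=
  WithLp.toLp 2 fun k => ∑ i, ∑ j, christoffel h c k i j * v i * w j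

/-- The covariant derivative `∇_w X` at `x` of a vector field `X` along `f : M → N`, for the
pull-back by `f` of the Levi-Civita connection of `(N, g)`:
`(∇_w X)^k = d(X^k)(w) + Γ^k_{ij}(f x) (df w)^i X^j` in the chart around `f x`. -/
def covDerivAlong {m : ℕ} {L : Type*} [TopologicalSpace L]
    [ChartedSpace (EuclideanSpace ℝ (Fin m)) L]
    (g : Metric n M) (f : L → M) (X : (y : L) → TangentSpace (𝓡 n) (f y)) (x : L)
    (w : TangentSpace (𝓡 m) x) : TangentSpace (𝓡 n) (f x) :=
  let dX : EuclideanSpace ℝ (Fin n) :=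
    mfderiv (𝓡 m) 𝓘(ℝ, EuclideanSpace ℝ (Fin n))
      (fun y : L => (trivializationAt (EuclideanSpace ℝ (Fin n))
        (fun z : M => TangentSpace (𝓡 n) z) (f x) ⟨f y, X y⟩).2) x w
  dX + christoffelVec g (f x) (mfderiv (𝓡 m) (𝓡 n) f x w) (X x)

variable [T2Space M] [SigmaCompactSpace M]

variable (n M) in
/-- A smooth partition of unity subordinate to the domains of the charts. -/
def chartPartition : SmoothPartitionOfUnity M (𝓡 n) M Set.univ :=
  (SmoothPartitionOfUnity.exists_isSubordinate_chartAt_source (𝓡 n) M).choose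

/-- The Riemannian volume measure: `∫ f dvol_h = ∑_c ∫ ρ_c f √(det h_{ij}) dx`, the summand with
index `c` being computed in the chart around `c`. -/
def volumeMeasure [MeasurableSpace M] (h : Metric n M) : Measure M :=
  Measure.sum fun c : M =>
    ((volume.restrict (extChartAt (𝓡 n) c).target).withDensity fun p =>
      ENNReal.ofReal (chartPartition n M c ((extChartAt (𝓡 n) c).symm p) *
        √(gram h c ((extChartAt (𝓡 n) c).symm p)).det)).map (extChartAt (𝓡 n) c).symm

end Coordinates

/-! ### Conformal change of the metric -/

section ConformalMetric

variable {n : ℕ} {M : Type*} [TopologicalSpace M]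
  [ChartedSpace (EuclideanSpace ℝ (Fin n)) M] [IsManifold (𝓡 n) ∞ M]

set_option synthInstance.maxHeartbeats 400000 in
/-- The conformally changed metric `e^{2u} h`. -/
def conformalMetric (h : Metric n M) (u : M → ℝ) (hu : ContMDiff (𝓡 n) 𝓘(ℝ) ∞ u) :
    Metric n M where
  inner x := Real.exp (2 * u x) • h.inner x
  symm x v w := by
    simp [h.symm x v w]
  pos x v hv := by
    simpa using mul_pos (Real.exp_pos (2 * u x)) (h.pos x v hv)
  isVonNBounded x := by
    have hb := (h.isVonNBounded x).image
      ((Real.exp (- u x)) • ContinuousLinearMap.id ℝ (TangentSpace (𝓡 n) x))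
    refine hb.subset ?_
    intro v hv
    refine ⟨Real.exp (u x) • v, ?_, ?_⟩
    · have h2 : Real.exp (2 * u x) = Real.exp (u x) * Real.exp (u x) := by
        rw [← Real.exp_add]; ring_nf
      simp only [Set.mem_ofPred_eq, map_smul, smul_apply, smul_eq_mul] at hv ⊢
      rw [h2] at hv
      linarith
    · simp [smul_smul, ← Real.exp_add]
  contMDiff := by
    have hs : ContMDiff (𝓡 n) 𝓘(ℝ) ∞ (fun x => Real.exp (2 * u x)) :=
      Real.contDiff_exp.contMDiff.comp (contMDiff_const.mul hu)
    exact hs.smul_section h.contMDiff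

end ConformalMetric

/-! ### Two-dimensional spinors -/

section Algebra

/-- Clifford multiplication by the standard basis of `ℝ²` on the spinor module `ℂ²`,
with `γ_a γ_b + γ_b γ_a = -2 δ_{ab}`. -/
def gamma : Fin 2 → Matrix (Fin 2) (Fin 2) ℂ :=
  ![!![0, -1; 1, 0], !![0, Complex.I; Complex.I, 0]]

/-- The spinor representation of `Spin(2) = {a + b e₁e₂ : a² + b² = 1}`, which is identified with
the circle `{a + b i}`. The double covering of `SO(2)` is then `z ↦ z²`. -/
def spinRep (z : Circle) : Matrix (Fin 2) (Fin 2) ℂ :=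
  ((z : ℂ).re : ℂ) • (1 : Matrix (Fin 2) (Fin 2) ℂ) + ((z : ℂ).im : ℂ) • (gamma 0 * gamma 1)

variable {V : Type*} [AddCommGroup V] [Module ℝ V]

/-- Multiplication by a complex number on the complexification `V ⊗ ℂ = V × V`, where the pair
`(a, b)` stands for `a + i b`. -/
def cxSmul (z : ℂ) (w : V × V) : V × V :=
  (z.re • w.1 - z.im • w.2, z.im • w.1 + z.re • w.2)

/-- The action of a complex `2 × 2` matrix on `ℂ² ⊗ V = (V ⊗ ℂ)²`. -/
def matAct (A : Matrix (Fin 2) (Fin 2) ℂ) (ψ : Fin 2 → V × V) : Fin 2 → V × V :=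
  fun a => ∑ b, cxSmul (A a b) (ψ b)

/-- The Hermitian product on `ℂ² ⊗ V` induced by the standard one of `ℂ²` and the real inner
product `g` of `V`, conjugate linear in the first variable. -/
def hermitian (g : V → V → ℝ) (χ ξ : Fin 2 → V × V) : ℂ :=
  ∑ a, (((g (χ a).1 (ξ a).1 + g (χ a).2 (ξ a).2 : ℝ) : ℂ) +
    ((g (χ a).1 (ξ a).2 - g (χ a).2 (ξ a).1 : ℝ) : ℂ) * Complex.I)

end Algebra

section Spin

variable {M : Type*} [TopologicalSpace M]
  [ChartedSpace (EuclideanSpace ℝ (Fin 2)) M] [IsManifold (𝓡 2) ∞ M]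

/-- A spin structure (together with the orientation it induces) on a Riemannian surface `(M, h)`:
an open cover `U i` with smooth orthonormal frames `e i`, any two of which differ on the
overlaps by rotations, and smooth lifts `lift i j` of these rotations to `Spin(2)`, which satisfy
the cocycle condition. The `i`-th frame is the image of a local section `s_i` of the principal
`Spin(2)`-bundle, and `s_j = s_i · lift i j`. -/
structure SpinStructure (h : Metric 2 M) where
  ι : Type*
  U : ι → Set M
  isOpen (i : ι) : IsOpen (U i)
  cover (x : M) : ∃ i, x ∈ U i
  e : ι → Fin 2 → (x : M) → TangentSpace (𝓡 2) x
  e_smooth (i : ι) (a : Fin 2) : ContMDiffOn (𝓡 2) (𝓡 2).tangent ∞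
    (fun x => (⟨x, e i a x⟩ : TangentBundle (𝓡 2) M)) (U i)
  orthonormal (i : ι) (x : M) (hx : x ∈ U i) (a b : Fin 2) :
    h.inner x (e i a x) (e i b x) = if a = b then 1 else 0
  lift : ι → ι → M → Circle
  lift_smooth (i j : ι) : ContMDiffOn (𝓡 2) 𝓘(ℝ, ℂ) ∞ (fun x => (lift i j x : ℂ)) (U i ∩ U j)
  lift_zero (i j : ι) (x : M) (hx : x ∈ U i ∩ U j) :
    e j 0 x = ((lift i j x : ℂ) ^ 2).re • e i 0 x + ((lift i j x : ℂ) ^ 2).im • e i 1 x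
  lift_one (i j : ι) (x : M) (hx : x ∈ U i ∩ U j) :
    e j 1 x = -((lift i j x : ℂ) ^ 2).im • e i 0 x + ((lift i j x : ℂ) ^ 2).re • e i 1 x
  cocycle (i j k : ι) (x : M) (hx : x ∈ U i ∩ U j ∩ U k) :
    lift i j x * lift j k x = lift i k x

/-- The spin structure on `(M, e^{2u} h)` that corresponds to a spin structure on `(M, h)`:
the frames are rescaled by `e^{-u}` and the `Spin(2)`-bundle is unchanged. -/
def SpinStructure.conformal {h : Metric 2 M} (s : SpinStructure h) (u : M → ℝ)
    (hu : ContMDiff (𝓡 2) 𝓘(ℝ) ∞ u) : SpinStructure (conformalMetric h u hu) where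
  ι := s.ι
  U := s.U
  isOpen := s.isOpen
  cover := s.cover
  e i a x := Real.exp (- u x) • s.e i a x
  e_smooth i a := by
    have hs : ContMDiff (𝓡 2) 𝓘(ℝ) ∞ (fun x => Real.exp (- u x)) :=
      Real.contDiff_exp.contMDiff.comp hu.neg
    exact hs.contMDiffOn.smul_section (s.e_smooth i a)
  orthonormal i x hx a b := by
    have h1 : Real.exp (2 * u x) * (Real.exp (- u x) * Real.exp (- u x)) = 1 := by
      rw [← Real.exp_add, ← Real.exp_add]; ring_nf; simp
    have h2 := s.orthonormal i x hx a b
    simp only [conformalMetric, map_smul, smul_apply, smul_eq_mul, h2]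
    split_ifs <;> linarith
  lift := s.lift
  lift_smooth := s.lift_smooth
  lift_zero i j x hx := by
    rw [s.lift_zero i j x hx, smul_add, smul_comm, smul_comm (Real.exp (- u x)) _ (s.e i 1 x)]
  lift_one i j x hx := by
    rw [s.lift_one i j x hx, smul_add, smul_comm, smul_comm (Real.exp (- u x)) _ (s.e i 1 x)]
  cocycle := s.cocycle

/-- An index of the cover whose open set contains `x`. -/
def SpinStructure.idx {h : Metric 2 M} (s : SpinStructure h) (x : M) : s.ι :=
  (s.cover x).choose

variable {n : ℕ} {N : Type*} [TopologicalSpace N]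
  [ChartedSpace (EuclideanSpace ℝ (Fin n)) N] [IsManifold (𝓡 n) ∞ N]

variable (n) in
/-- A vector spinor, that is a smooth section of `ΣM ⊗ φ⁻¹TN`. In the spin frame `s_i` it is given
on `U i` by a function with values in `ℂ² ⊗ T_{φ(x)}N`, i.e. by a pair of complexified smooth
vector fields along `φ`; a change of spin frame acts by the spinor representation. -/
structure VectorSpinor {h : Metric 2 M} (s : SpinStructure h) (φ : M → N) where
  comp : s.ι → (x : M) → Fin 2 → TangentSpace (𝓡 n) (φ x) × TangentSpace (𝓡 n) (φ x)
  smooth_re (i : s.ι) (a : Fin 2) : ContMDiffOn (𝓡 2) (𝓡 n).tangent ∞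
    (fun x => (⟨φ x, (comp i x a).1⟩ : TangentBundle (𝓡 n) N)) (s.U i)
  smooth_im (i : s.ι) (a : Fin 2) : ContMDiffOn (𝓡 2) (𝓡 n).tangent ∞
    (fun x => (⟨φ x, (comp i x a).2⟩ : TangentBundle (𝓡 n) N)) (s.U i)
  transition (i j : s.ι) (x : M) (hx : x ∈ s.U i ∩ s.U j) :
    comp i x = matAct (spinRep (s.lift i j x)) (comp j x)

/-- Multiplying a smooth field along `φ` by a smooth function gives a smooth field. -/
theorem smul_along {m : ℕ} {L : Type*} [TopologicalSpace L]
    [ChartedSpace (EuclideanSpace ℝ (Fin m)) L] [IsManifold (𝓡 m) ∞ L] {φ : L → N}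
    {X : (x : L) → TangentSpace (𝓡 n) (φ x)} {f : L → ℝ} {U : Set L}
    (hf : ContMDiff (𝓡 m) 𝓘(ℝ) ∞ f)
    (hX : ContMDiffOn (𝓡 m) (𝓡 n).tangent ∞
      (fun x => (⟨φ x, X x⟩ : TangentBundle (𝓡 n) N)) U) :
    ContMDiffOn (𝓡 m) (𝓡 n).tangent ∞
      (fun x => (⟨φ x, f x • X x⟩ : TangentBundle (𝓡 n) N)) U := by
  intro x hx
  have hX' := Bundle.contMDiffWithinAt_totalSpace.1 (hX x hx)
  refine Bundle.contMDiffWithinAt_totalSpace.2 ⟨hX'.1, ?_⟩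
  have h1 := ((hf x).contMDiffWithinAt (s := U)).smul hX'.2
  have hbase : ∀ᶠ y in 𝓝[U] x, φ y ∈
      (trivializationAt (EuclideanSpace ℝ (Fin n))
        (fun z : N => TangentSpace (𝓡 n) z) (φ x)).baseSet :=
    hX'.1.continuousWithinAt.eventually
      ((trivializationAt (EuclideanSpace ℝ (Fin n))
        (fun z : N => TangentSpace (𝓡 n) z) (φ x)).open_baseSet.mem_nhds
        (FiberBundle.mem_baseSet_trivializationAt' (φ x)))
  refine h1.congr_of_eventuallyEq ?_ ?_
  · filter_upwards [hbase] with y hy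
    exact ((trivializationAt (EuclideanSpace ℝ (Fin n))
        (fun z : N => TangentSpace (𝓡 n) z) (φ x)).linear ℝ hy).map_smul (f y) (X y)
  · exact ((trivializationAt (EuclideanSpace ℝ (Fin n))
        (fun z : N => TangentSpace (𝓡 n) z) (φ x)).linear ℝ
        (FiberBundle.mem_baseSet_trivializationAt' (φ x))).map_smul (f x) (X x)

/-- The vector spinor `e^{-u/2} ψ` on `(M, e^{2u} h)`, where the spinor bundles of `(M, h)` and
`(M, e^{2u} h)` are identified isometrically by means of the spin frames. -/
def VectorSpinor.conformal {h : Metric 2 M} {s : SpinStructure h} {φ : M → N}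
    (ψ : VectorSpinor n s φ) (u : M → ℝ) (hu : ContMDiff (𝓡 2) 𝓘(ℝ) ∞ u) :
    VectorSpinor n (s.conformal u hu) φ where
  comp i x a := Real.exp (- u x / 2) • ψ.comp i x a
  smooth_re i a := by
    have hs : ContMDiff (𝓡 2) 𝓘(ℝ) ∞ (fun x => Real.exp (- u x / 2)) :=
      Real.contDiff_exp.contMDiff.comp (hu.neg.div_const 2)
    exact smul_along hs (ψ.smooth_re i a)
  smooth_im i a := by
    have hs : ContMDiff (𝓡 2) 𝓘(ℝ) ∞ (fun x => Real.exp (- u x / 2)) :=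
      Real.contDiff_exp.contMDiff.comp (hu.neg.div_const 2)
    exact smul_along hs (ψ.smooth_im i a)
  transition i j x hx := by
    funext a
    rw [ψ.transition i j x hx]
    simp only [matAct, cxSmul, Finset.smul_sum]
    refine Finset.sum_congr rfl fun b _ => ?_
    ext <;> simp [SpinStructure.conformal, smul_add, smul_sub, smul_comm (Real.exp (- u x / 2))]

/-! ### The Dirac operator and the energy -/

/-- The connection form `ω(w) = h(∇_w e_1, e_2)` of the `i`-th frame. -/
def connectionForm {h : Metric 2 M} (s : SpinStructure h) (i : s.ι) (x : M)
    (w : TangentSpace (𝓡 2) x) : ℝ :=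
  h.inner x (covDerivAlong h (id : M → M) (s.e i 0) x w) (s.e i 1 x)

/-- The connection `∇̃` of `ΣM ⊗ φ⁻¹TN`, in the `i`-th spin frame: the covariant derivative of the
components along `φ`, plus the spin connection `(1/4) ∑ h(∇_w e_a, e_b) γ_a γ_b`, which is
`(1/2) ω(w) γ_1 γ_2`. -/
def twistedDeriv {h : Metric 2 M} {s : SpinStructure h} {φ : M → N} (g : Metric n N)
    (ψ : VectorSpinor n s φ) (i : s.ι) (x : M) (w : TangentSpace (𝓡 2) x) :
    Fin 2 → TangentSpace (𝓡 n) (φ x) × TangentSpace (𝓡 n) (φ x) :=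
  (fun a => (covDerivAlong g φ (fun y => (ψ.comp i y a).1) x w,
      covDerivAlong g φ (fun y => (ψ.comp i y a).2) x w)) +
    ((1 / 2) * connectionForm s i x w) • matAct (gamma 0 * gamma 1) (ψ.comp i x)

/-- The twisted Dirac operator `D̸ψ = ∑ e_a · ∇̃_{e_a} ψ`, in the `i`-th spin frame. -/
def dirac {h : Metric 2 M} {s : SpinStructure h} {φ : M → N} (g : Metric n N)
    (ψ : VectorSpinor n s φ) (i : s.ι) (x : M) :
    Fin 2 → TangentSpace (𝓡 n) (φ x) × TangentSpace (𝓡 n) (φ x) :=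
  ∑ a, matAct (gamma a) (twistedDeriv g ψ i x (s.e i a x))

/-- `|dφ|² = h^{αβ} g(∂_α φ, ∂_β φ)`. -/
def dirichletDensity (h : Metric 2 M) (g : Metric n N) (φ : M → N) (x : M) : ℝ :=
  ∑ α, ∑ β, (gram h x x)⁻¹ α β *
    g.inner (φ x) (mfderiv (𝓡 2) (𝓡 n) φ x (coordVec x x α))
      (mfderiv (𝓡 2) (𝓡 n) φ x (coordVec x x β))

/-- The Hermitian product `⟨ψ, D̸ψ⟩`; its value does not depend on the spin frame around `x`. -/
def diracDensity {h : Metric 2 M} {s : SpinStructure h} {φ : M → N} (g : Metric n N)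
    (ψ : VectorSpinor n s φ) (x : M) : ℂ :=
  hermitian (fun v w => g.inner (φ x) v w) (ψ.comp (s.idx x) x) (dirac g ψ (s.idx x) x)

/-- The function `(φ^*B)(e_1, e_2)`, for an oriented orthonormal frame `(e_1, e_2)`; the two-form
`φ^*B` is this function times the area form of `h`. -/
def magneticDensity {h : Metric 2 M} (s : SpinStructure h) (B : TwoForm n N) (φ : M → N)
    (x : M) : ℝ :=
  B.form (φ x) (mfderiv (𝓡 2) (𝓡 n) φ x (s.e (s.idx x) 0 x))
    (mfderiv (𝓡 2) (𝓡 n) φ x (s.e (s.idx x) 1 x))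

variable [T2Space M] [CompactSpace M] [MeasurableSpace M]

/-- `∫_M |dφ|² dvol_h`. -/
def dirichletTerm (h : Metric 2 M) (g : Metric n N) (φ : M → N) : ℝ :=
  ∫ x, dirichletDensity h g φ x ∂(volumeMeasure h)

/-- `∫_M ⟨ψ, D̸ψ⟩ dvol_h`. -/
def diracTerm {h : Metric 2 M} {s : SpinStructure h} {φ : M → N} (g : Metric n N)
    (ψ : VectorSpinor n s φ) : ℂ :=
  ∫ x, diracDensity g ψ x ∂(volumeMeasure h)

/-- `∫_M φ^*B`, for the orientation given by the spin structure. -/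
def magneticTerm {h : Metric 2 M} (s : SpinStructure h) (B : TwoForm n N) (φ : M → N) : ℝ :=
  ∫ x, magneticDensity s B φ x ∂(volumeMeasure h)

/-- The energy `E_B(φ, ψ) = (1/2) ∫_M (|dφ|² + ⟨ψ, D̸ψ⟩ + 2 φ^*B)`. It is written as a complex
number because the Hermitian product `⟨ψ, D̸ψ⟩` may have an imaginary part at a point (a divergence,
whose integral vanishes). -/
def energy {h : Metric 2 M} {s : SpinStructure h} {φ : M → N} (g : Metric n N) (B : TwoForm n N)
    (ψ : VectorSpinor n s φ) : ℂ :=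
  (1 / 2) * ∫ x, ((dirichletDensity h g φ x : ℂ) + diracDensity g ψ x +
    2 * (magneticDensity s B φ x : ℂ)) ∂(volumeMeasure h)

end Spin

end MagneticDirac

end

/-! Under `h ↦ e^{2u} h` the area measure is multiplied by `e^{2u}`, so it is enough that all
three densities are multiplied by `e^{-2u}`. For `|dφ|²` and `(φ^*B)(e_1, e_2)` this is algebra. For
the Dirac term, the Levi-Civita connection of `e^{2u} h` changes the spin connection by a term
whose Clifford contraction is `(1/2) grad u · ψ`, and differentiating `e^{-u/2}` gives the opposite
of it. Hence `D̸ψ̃ = e^{-3u/2} D̸ψ`, and `⟨ψ̃, D̸ψ̃⟩ = e^{-2u} ⟨ψ, D̸ψ⟩`. -/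

noncomputable section

namespace MagneticDirac

section Calculus

variable {n : ℕ} {M : Type*} [TopologicalSpace M] [ChartedSpace (EuclideanSpace ℝ (Fin n)) M]

theorem mvfderiv_eq_fderiv_comp_extChartAt_symm {E : Type*} [NormedAddCommGroup E]
    [NormedSpace ℝ E] {f : M → E} {x : M} (hf : MDifferentiableAt (𝓡 n) 𝓘(ℝ, E) f x) :
    mvfderiv (𝓡 n) f x = fderiv ℝ (f ∘ (extChartAt (𝓡 n) x).symm) (extChartAt (𝓡 n) x x) := by
  rw [hf.mvfderiv, ModelWithCorners.range_eq_univ, fderivWithin_univ]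
  rfl

theorem mvfderiv_comp_of_hasDerivAt {F : ℝ → ℝ} {F' : ℝ} {f : M → ℝ} {x : M}
    (hF : HasDerivAt F F' (f x)) (hf : MDifferentiableAt (𝓡 n) 𝓘(ℝ) f x) :
    mvfderiv (𝓡 n) (fun y => F (f y)) x = F' • mvfderiv (𝓡 n) f x := by
  ext v
  have hcomp := (hF.hasFDerivAt.hasMFDerivAt.comp x hf.hasMFDerivAt).mfderiv
  calc mvfderiv (𝓡 n) (fun y => F (f y)) x v
      = mvfderiv (𝓡 n) f x v * F' := congrArg (fun A => A v) hcomp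
    _ = F' * mvfderiv (𝓡 n) f x v := mul_comm _ _

end Calculus

section Coordinates

variable {n : ℕ} {M : Type*} [TopologicalSpace M]
  [ChartedSpace (EuclideanSpace ℝ (Fin n)) M] [IsManifold (𝓡 n) ∞ M]

theorem trivializationAt_self_apply (c : M) (v : TangentSpace (𝓡 n) c) :
    (trivializationAt (EuclideanSpace ℝ (Fin n)) (fun x : M => TangentSpace (𝓡 n) x) c
      ⟨c, v⟩).2 = v := by
  rw [TangentBundle.trivializationAt_apply]
  simpa using (tangentBundleCore (𝓡 n) M).coordChange_self (achart _ c) c (by simp) v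

theorem coordVec_self (c : M) (k : Fin n) : coordVec c c k = EuclideanSpace.single k (1 : ℝ) := by
  rw [coordVec, TangentBundle.symmL_trivializationAt_eq_core (by simp)]
  exact (tangentBundleCore (𝓡 n) M).coordChange_self (achart _ c) c (by simp) _

theorem contMDiffOn_coordVec (c : M) (k : Fin n) :
    ContMDiffOn (𝓡 n) (𝓡 n).tangent ∞
      (fun x => (⟨x, coordVec c x k⟩ : TangentBundle (𝓡 n) M)) (extChartAt (𝓡 n) c).source := by
  set t := trivializationAt (EuclideanSpace ℝ (Fin n)) (fun x : M => TangentSpace (𝓡 n) x) c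
  have hsource : (extChartAt (𝓡 n) c).source = t.baseSet := by simp [t]
  rw [hsource]
  refine (t.contMDiffOn_localFrame_baseSet (I := 𝓡 n) ∞
    (EuclideanSpace.basisFun (Fin n) ℝ).toBasis k).congr fun x hx => ?_
  have hcoord : coordVec c x k = t.symm x (EuclideanSpace.single k 1) := t.symmL_apply hx _
  rw [hcoord, t.localFrame_apply_of_mem_baseSet _ hx]
  simp [Bundle.Trivialization.basisAt]

theorem contMDiffOn_gram (h : Metric n M) (c : M) (i j : Fin n) :
    ContMDiffOn (𝓡 n) 𝓘(ℝ) ∞ (fun x => gram h c x i j) (extChartAt (𝓡 n) c).source := by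
  have hsection := ContMDiffOn.clm_bundle_apply₂ (F₁ := EuclideanSpace ℝ (Fin n))
    (F₂ := EuclideanSpace ℝ (Fin n)) (F₃ := ℝ) (E₃ := Bundle.Trivial M ℝ)
    (h.contMDiff.contMDiffOn (s := (extChartAt (𝓡 n) c).source))
    (contMDiffOn_coordVec c i) (contMDiffOn_coordVec c j)
  exact fun x hx => (Bundle.contMDiffWithinAt_totalSpace.1 (hsection x hx)).2

theorem mdifferentiableAt_gram (h : Metric n M) (c : M) (i j : Fin n) :
    MDifferentiableAt (𝓡 n) 𝓘(ℝ) (fun x => gram h c x i j) c :=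
  ((contMDiffOn_gram h c i j).contMDiffAt (extChartAt_source_mem_nhds c)).mdifferentiableAt
    (by simp)

/-- The coordinate derivative `∂_i u` at the centre `c` of the chart around `c`. -/
def coordDeriv (u : M → ℝ) (c : M) (i : Fin n) : ℝ :=
  mvfderiv (𝓡 n) u c (coordVec c c i)

theorem gramDeriv_eq_coordDeriv (h : Metric n M) (c : M) (i j l : Fin n) :
    gramDeriv h c i j l = coordDeriv (fun x => gram h c x j l) c i := by
  rw [coordDeriv, mvfderiv_eq_fderiv_comp_extChartAt_symm (mdifferentiableAt_gram h c j l),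
    coordVec_self]
  rfl

theorem gram_symm (h : Metric n M) (c x : M) (i j : Fin n) : gram h c x i j = gram h c x j i :=
  h.symm x _ _

theorem sum_smul_coordVec (c : M) (v : EuclideanSpace ℝ (Fin n)) :
    ∑ i, v i • coordVec c c i = v := by
  have hrepr := (EuclideanSpace.basisFun (Fin n) ℝ).sum_repr v
  simp only [EuclideanSpace.basisFun_apply, EuclideanSpace.basisFun_repr] at hrepr
  simp only [coordVec_self]
  exact hrepr

theorem mvfderiv_eq_sum_coordDeriv (u : M → ℝ) (c : M) (v : EuclideanSpace ℝ (Fin n)) :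
    mvfderiv (𝓡 n) u c v = ∑ i, v i * coordDeriv u c i := by
  conv_lhs => rw [← sum_smul_coordVec c v]
  simp only [map_sum, map_smul, smul_eq_mul, coordDeriv]

theorem inner_eq_sum_gram (h : Metric n M) (c : M) (v w : EuclideanSpace ℝ (Fin n)) :
    h.inner c v w = ∑ i, ∑ j, v i * w j * gram h c c i j := by
  conv_lhs => rw [← sum_smul_coordVec c v, ← sum_smul_coordVec c w]
  simp only [map_sum, map_smul, sum_apply, smul_apply, smul_eq_mul, Finset.mul_sum, gram]
  rw [Finset.sum_comm]
  exact Finset.sum_congr rfl fun i _ => Finset.sum_congr rfl fun j _ => by ring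

end Coordinates

theorem map_withDensity_comp {α β : Type*} [MeasurableSpace α] [MeasurableSpace β]
    {μ : Measure α} {f : α → β} (hf : AEMeasurable f μ) {G : β → ENNReal} (hG : Measurable G) :
    (μ.withDensity (G ∘ f)).map f = (μ.map f).withDensity G := by
  ext t ht
  rw [Measure.map_apply_of_aemeasurable (hf.mono_ac (withDensity_absolutelyContinuous _ _)) ht,
    withDensity_apply₀ _ (hf.nullMeasurableSet_preimage ht), withDensity_apply _ ht,
    Measure.restrict_map_of_aemeasurable hf ht, lintegral_map' hG.aemeasurable hf.restrict]
  rfl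

section Volume

variable {n : ℕ} {M : Type*} [TopologicalSpace M]
  [ChartedSpace (EuclideanSpace ℝ (Fin n)) M] [IsManifold (𝓡 n) ∞ M]

theorem gram_conformalMetric (h : Metric n M) {u : M → ℝ} (hu : ContMDiff (𝓡 n) 𝓘(ℝ) ∞ u)
    (c x : M) : gram (conformalMetric h u hu) c x = Real.exp (2 * u x) • gram h c x := by
  ext i j
  simp [gram, conformalMetric]

theorem sqrt_det_gram_conformalMetric (h : Metric n M) {u : M → ℝ}
    (hu : ContMDiff (𝓡 n) 𝓘(ℝ) ∞ u) (c x : M) :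
    √(gram (conformalMetric h u hu) c x).det = Real.exp (n * u x) * √(gram h c x).det := by
  have hexp : Real.exp (2 * u x) ^ n = Real.exp (n * u x) ^ 2 := by
    simp only [← Real.exp_nat_mul]
    ring_nf
  rw [gram_conformalMetric, Matrix.det_smul, Fintype.card_fin, hexp,
    Real.sqrt_mul (by positivity), Real.sqrt_sq (Real.exp_pos _).le]

theorem continuousOn_sqrt_det_gram (h : Metric n M) (c : M) :
    ContinuousOn (fun x => √(gram h c x).det) (extChartAt (𝓡 n) c).source := by
  have hgram : ContinuousOn (gram h c) (extChartAt (𝓡 n) c).source :=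
    continuousOn_pi.2 fun i => continuousOn_pi.2 fun j => (contMDiffOn_gram h c i j).continuousOn
  exact Real.continuous_sqrt.comp_continuousOn (continuous_id.matrix_det.comp_continuousOn hgram)

variable [T2Space M] [SigmaCompactSpace M] [MeasurableSpace M] [BorelSpace M]

theorem volumeMeasure_conformalMetric (h : Metric n M) {u : M → ℝ}
    (hu : ContMDiff (𝓡 n) 𝓘(ℝ) ∞ u) :
    volumeMeasure (conformalMetric h u hu) =
      (volumeMeasure h).withDensity fun x => ENNReal.ofReal (Real.exp (n * u x)) := by
  have hexp : Measurable fun x => ENNReal.ofReal (Real.exp (n * u x)) :=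
    (Real.continuous_exp.comp (hu.continuous.const_mul _)).measurable.ennreal_ofReal
  simp only [volumeMeasure, withDensity_sum]
  congr 1
  funext c
  have htarget : MeasurableSet (extChartAt (𝓡 n) c).target :=
    (isOpen_extChartAt_target c).measurableSet
  have hchart : ContinuousOn (extChartAt (𝓡 n) c).symm (extChartAt (𝓡 n) c).target :=
    continuousOn_extChartAt_symm c
  have hchart_meas := hchart.aemeasurable (μ := volume) htarget
  have hdensity : AEMeasurable (fun p => ENNReal.ofReal
      (chartPartition n M c ((extChartAt (𝓡 n) c).symm p) *
        √(gram h c ((extChartAt (𝓡 n) c).symm p)).det))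
      (volume.restrict (extChartAt (𝓡 n) c).target) :=
    (((chartPartition n M c).contMDiff.continuous.comp_continuousOn hchart).mul
      ((continuousOn_sqrt_det_gram h c).comp hchart (extChartAt (𝓡 n) c).symm.mapsTo)).aemeasurable
      htarget |>.ennreal_ofReal
  rw [← map_withDensity_comp (hchart_meas.mono_ac (withDensity_absolutelyContinuous _ _)) hexp,
    ← withDensity_mul₀ hdensity (hexp.comp_aemeasurable hchart_meas)]
  congr 2
  funext p
  rw [Pi.mul_apply, Function.comp_apply, ← ENNReal.ofReal_mul' (Real.exp_pos _).le,
    sqrt_det_gram_conformalMetric, mul_left_comm, mul_comm (Real.exp _)]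

theorem integral_volumeMeasure_conformalMetric {E : Type*} [NormedAddCommGroup E]
    [NormedSpace ℝ E] (h : Metric n M) {u : M → ℝ} (hu : ContMDiff (𝓡 n) 𝓘(ℝ) ∞ u) (f : M → E) :
    ∫ x, f x ∂(volumeMeasure (conformalMetric h u hu)) =
      ∫ x, Real.exp (n * u x) • f x ∂(volumeMeasure h) := by
  have hexp : Measurable fun x => ENNReal.ofReal (Real.exp (n * u x)) :=
    (Real.continuous_exp.comp (hu.continuous.const_mul _)).measurable.ennreal_ofReal
  rw [volumeMeasure_conformalMetric, integral_withDensity_eq_integral_toReal_smul hexp (by simp)]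
  simp only [ENNReal.toReal_ofReal (Real.exp_pos _).le]

theorem integral_volumeMeasure_conformalMetric_of_weight {E : Type*} [NormedAddCommGroup E]
    [NormedSpace ℝ E] (h : Metric n M) {u : M → ℝ} (hu : ContMDiff (𝓡 n) 𝓘(ℝ) ∞ u)
    {f f' : M → E} (hf : ∀ x, f' x = Real.exp (-(n * u x)) • f x) :
    ∫ x, f' x ∂(volumeMeasure (conformalMetric h u hu)) = ∫ x, f x ∂(volumeMeasure h) := by
  simp only [integral_volumeMeasure_conformalMetric, hf, smul_smul, ← Real.exp_add,
    add_neg_cancel, Real.exp_zero, one_smul]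

end Volume

section Christoffel

variable {n : ℕ} {M : Type*} [TopologicalSpace M]
  [ChartedSpace (EuclideanSpace ℝ (Fin n)) M] [IsManifold (𝓡 n) ∞ M]

theorem isUnit_det_gram (h : Metric n M) (c : M) : IsUnit (gram h c c).det := by
  rw [isUnit_iff_ne_zero]
  intro hdet
  obtain ⟨v, hv, hGv⟩ := Matrix.exists_mulVec_eq_zero_iff.2 hdet
  have hpos := h.pos c (WithLp.toLp 2 v : EuclideanSpace ℝ (Fin n))
    ((WithLp.toLp_eq_zero 2).not.2 hv)
  refine hpos.ne' ?_
  calc h.inner c (WithLp.toLp 2 v : EuclideanSpace ℝ (Fin n)) (WithLp.toLp 2 v)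
      = v ⬝ᵥ (gram h c c).mulVec v := by
        simp only [inner_eq_sum_gram, Matrix.mulVec, dotProduct, Finset.mul_sum]
        exact Finset.sum_congr rfl fun i _ => Finset.sum_congr rfl fun j _ => by ring
    _ = 0 := by rw [hGv, dotProduct_zero]

theorem inv_gram_conformalMetric (h : Metric n M) {u : M → ℝ} (hu : ContMDiff (𝓡 n) 𝓘(ℝ) ∞ u)
    (c : M) : (gram (conformalMetric h u hu) c c)⁻¹ =
      Real.exp (-(2 * u c)) • (gram h c c)⁻¹ := by
  rw [gram_conformalMetric, Real.exp_neg]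
  exact Matrix.inv_smul' (gram h c c) (Units.mk0 _ (Real.exp_pos (2 * u c)).ne')
    (isUnit_det_gram h c)

/-- The gradient of `u` at `c`, that is the vector metrically dual to `du`. It is a vector of the
model space, which is `TangentSpace (𝓡 n) c` through the chart around `c`. -/
def gradient (h : Metric n M) (u : M → ℝ) (c : M) : EuclideanSpace ℝ (Fin n) :=
  WithLp.toLp 2 ((gram h c c)⁻¹.mulVec (coordDeriv u c))

theorem inner_gradient (h : Metric n M) (u : M → ℝ) (c : M) (v : EuclideanSpace ℝ (Fin n)) :
    h.inner c (gradient h u c) v = mvfderiv (𝓡 n) u c v := by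
  have hlower (i : Fin n) : ∑ j, gram h c c i j * gradient h u c j = coordDeriv u c i := by
    have hmul : (gram h c c).mulVec (gradient h u c).ofLp = coordDeriv u c := by
      rw [gradient, Matrix.mulVec_mulVec, Matrix.mul_nonsing_inv _ (isUnit_det_gram h c),
        Matrix.one_mulVec]
    exact congrFun hmul i
  refine (h.symm c _ _).trans ?_
  simp only [mvfderiv_eq_sum_coordDeriv, inner_eq_sum_gram, ← hlower, Finset.mul_sum]
  exact Finset.sum_congr rfl fun i _ => Finset.sum_congr rfl fun j _ => by ring

theorem gramDeriv_conformalMetric (h : Metric n M) {u : M → ℝ} (hu : ContMDiff (𝓡 n) 𝓘(ℝ) ∞ u)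
    (c : M) (i j l : Fin n) :
    gramDeriv (conformalMetric h u hu) c i j l = Real.exp (2 * u c) * (gramDeriv h c i j l +
      2 * coordDeriv u c i * gram h c c j l) := by
  have hdu : MDifferentiableAt (𝓡 n) 𝓘(ℝ) u c := hu.mdifferentiable (by simp) c
  have hexp : HasDerivAt (fun t => Real.exp (2 * t)) (2 * Real.exp (2 * u c)) (u c) :=
    ((hasDerivAt_id (u c)).const_mul 2).exp.congr_deriv (by simp [mul_comm])
  have hdexp : MDifferentiableAt (𝓡 n) 𝓘(ℝ) (fun x => Real.exp (2 * u x)) c :=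
    hexp.differentiableAt.mdifferentiableAt.comp c hdu
  simp only [gramDeriv_eq_coordDeriv, coordDeriv, gram_conformalMetric, Matrix.smul_apply]
  rw [mvfderiv_fun_smul hdexp (mdifferentiableAt_gram h c j l),
    mvfderiv_comp_of_hasDerivAt hexp hdu]
  simp only [add_apply, smul_apply, smul_eq_mul, ContinuousLinearMap.smulRight_apply]
  ring

theorem christoffel_conformalMetric (h : Metric n M) {u : M → ℝ}
    (hu : ContMDiff (𝓡 n) 𝓘(ℝ) ∞ u) (c : M) (k i j : Fin n) :
    christoffel (conformalMetric h u hu) c k i j = christoffel h c k i j +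
      (1 : Matrix (Fin n) (Fin n) ℝ) k j * coordDeriv u c i +
      (1 : Matrix (Fin n) (Fin n) ℝ) k i * coordDeriv u c j -
      gram h c c i j * gradient h u c k := by
  have hexp : Real.exp (-(2 * u c)) * Real.exp (2 * u c) = 1 := by
    rw [← Real.exp_add, neg_add_cancel, Real.exp_zero]
  have hinv (a : Fin n) :
      (1 : Matrix (Fin n) (Fin n) ℝ) k a = ∑ l, (gram h c c)⁻¹ k l * gram h c c a l := by
    simp only [← Matrix.nonsing_inv_mul _ (isUnit_det_gram h c), Matrix.mul_apply,
      gram_symm h c c a]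
  have hgradient : gradient h u c k = ∑ l, (gram h c c)⁻¹ k l * coordDeriv u c l := rfl
  rw [hinv, hinv, hgradient]
  simp only [christoffel, inv_gram_conformalMetric, gramDeriv_conformalMetric, Matrix.smul_apply,
    smul_eq_mul, Finset.mul_sum, Finset.sum_mul, ← Finset.sum_add_distrib,
    ← Finset.sum_sub_distrib]
  refine Finset.sum_congr rfl fun l _ => ?_
  linear_combination (1 / 2 * (gram h c c)⁻¹ k l * (gramDeriv h c i j l + gramDeriv h c j i l -
    gramDeriv h c l i j + 2 * (coordDeriv u c i * gram h c c j l +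
      coordDeriv u c j * gram h c c i l - coordDeriv u c l * gram h c c i j))) * hexp

theorem christoffelVec_conformalMetric (h : Metric n M) {u : M → ℝ}
    (hu : ContMDiff (𝓡 n) 𝓘(ℝ) ∞ u) (c : M) (v w : EuclideanSpace ℝ (Fin n)) :
    christoffelVec (conformalMetric h u hu) c v w = christoffelVec h c v w +
      mvfderiv (𝓡 n) u c v • w + mvfderiv (𝓡 n) u c w • v -
      h.inner c v w • gradient h u c := by
  ext k
  have hw : mvfderiv (𝓡 n) u c v * w k = ∑ i, ∑ j, (1 : Matrix (Fin n) (Fin n) ℝ) k j *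
      coordDeriv u c i * v i * w j := by
    simp [mvfderiv_eq_sum_coordDeriv u c v, Matrix.one_apply, Finset.mul_sum, mul_comm]
  have hv : mvfderiv (𝓡 n) u c w * v k = ∑ i, ∑ j, (1 : Matrix (Fin n) (Fin n) ℝ) k i *
      coordDeriv u c j * v i * w j := by
    rw [Finset.sum_comm]
    simp [mvfderiv_eq_sum_coordDeriv u c w, Matrix.one_apply, Finset.mul_sum,
      mul_assoc, mul_comm, mul_left_comm]
  have hvw : h.inner c v w * gradient h u c k = ∑ i, ∑ j, gram h c c i j * gradient h u c k *
      v i * w j := by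
    simp only [inner_eq_sum_gram, Finset.sum_mul]
    exact Finset.sum_congr rfl fun i _ => Finset.sum_congr rfl fun j _ => by ring
  simp only [PiLp.add_apply, PiLp.sub_apply, PiLp.smul_apply, smul_eq_mul, hw, hv, hvw,
    christoffelVec, christoffel_conformalMetric, ← Finset.sum_add_distrib,
    ← Finset.sum_sub_distrib, add_mul, sub_mul]

end Christoffel

section CovariantDerivative

variable {n : ℕ} {M : Type*} [TopologicalSpace M]
  [ChartedSpace (EuclideanSpace ℝ (Fin n)) M] [IsManifold (𝓡 n) ∞ M]
  {m : ℕ} {L : Type*} [TopologicalSpace L] [ChartedSpace (EuclideanSpace ℝ (Fin m)) L]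

theorem christoffelVec_smul_left (h : Metric n M) (c : M) (r : ℝ)
    (v w : EuclideanSpace ℝ (Fin n)) :
    christoffelVec h c (r • v) w = r • christoffelVec h c v w := by
  ext k
  simp only [christoffelVec, PiLp.smul_apply, smul_eq_mul, Finset.mul_sum]
  exact Finset.sum_congr rfl fun i _ => Finset.sum_congr rfl fun j _ => by ring

theorem christoffelVec_smul_right (h : Metric n M) (c : M) (r : ℝ)
    (v w : EuclideanSpace ℝ (Fin n)) :
    christoffelVec h c v (r • w) = r • christoffelVec h c v w := by
  ext k
  simp only [christoffelVec, PiLp.smul_apply, smul_eq_mul, Finset.mul_sum]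
  exact Finset.sum_congr rfl fun i _ => Finset.sum_congr rfl fun j _ => by ring

theorem inner_christoffelVec_conformalMetric (h : Metric n M) {u : M → ℝ}
    (hu : ContMDiff (𝓡 n) 𝓘(ℝ) ∞ u) (c : M) (v w z : EuclideanSpace ℝ (Fin n)) :
    h.inner c (christoffelVec (conformalMetric h u hu) c v w) z =
      h.inner c (christoffelVec h c v w) z + mvfderiv (𝓡 n) u c v * h.inner c w z +
        mvfderiv (𝓡 n) u c w * h.inner c v z - mvfderiv (𝓡 n) u c z * h.inner c v w := by
  let b : EuclideanSpace ℝ (Fin n) →L[ℝ] EuclideanSpace ℝ (Fin n) →L[ℝ] ℝ := h.inner c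
  calc b (christoffelVec (conformalMetric h u hu) c v w) z
      = b (christoffelVec h c v w) z + mvfderiv (𝓡 n) u c v * b w z +
          mvfderiv (𝓡 n) u c w * b v z - b v w * b (gradient h u c) z := by
        rw [christoffelVec_conformalMetric]
        simp only [map_add, map_sub, map_smul, add_apply, sub_apply, smul_apply, smul_eq_mul]
        rfl
    _ = _ := by rw [mul_comm (b v w)]; exact inner_gradient h u c z ▸ rfl

theorem covDerivAlong_smul (g : Metric n M) (f : L → M)
    (X : (y : L) → TangentSpace (𝓡 n) (f y)) (x : L) (r : ℝ) (w : TangentSpace (𝓡 m) x) :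
    covDerivAlong g f X x (r • w) = r • covDerivAlong g f X x w := by
  simp only [covDerivAlong, map_smul]
  exact (congrArg _ (christoffelVec_smul_left g (f x) r _ _)).trans (smul_add r _ _).symm

theorem covDerivAlong_fun_smul (g : Metric n M) (f : L → M)
    (X : (y : L) → TangentSpace (𝓡 n) (f y)) (x : L) (w : TangentSpace (𝓡 m) x) {a : L → ℝ}
    (ha : MDifferentiableAt (𝓡 m) 𝓘(ℝ) a x)
    (hX : MDifferentiableAt (𝓡 m) (𝓡 n).tangent
      (fun y => (⟨f y, X y⟩ : TangentBundle (𝓡 n) M)) x) :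
    covDerivAlong g f (fun y => a y • X y) x w =
      a x • covDerivAlong g f X x w + mvfderiv (𝓡 m) a x w • X x := by
  set t := trivializationAt (EuclideanSpace ℝ (Fin n)) (fun z : M => TangentSpace (𝓡 n) z) (f x)
  obtain ⟨hf, hcoord⟩ := (mdifferentiableAt_totalSpace (IB := 𝓡 n) _).1 hX
  have hbase : ∀ᶠ y in 𝓝 x, f y ∈ t.baseSet :=
    hf.continuousAt.eventually
      (t.open_baseSet.mem_nhds (FiberBundle.mem_baseSet_trivializationAt' (f x)))
  have hlinear : (fun y => (t ⟨f y, a y • X y⟩).2) =ᶠ[𝓝 x] fun y => a y • (t ⟨f y, X y⟩).2 := by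
    filter_upwards [hbase] with y hy
    exact (t.linear ℝ hy).map_smul (a y) (X y)
  have hleibniz : mvfderiv (𝓡 m) (fun y => (t ⟨f y, a y • X y⟩).2) x w =
      a x • mvfderiv (𝓡 m) (fun y => (t ⟨f y, X y⟩).2) x w +
        mvfderiv (𝓡 m) a x w • (t ⟨f x, X x⟩).2 := by
    have hderiv : mvfderiv (𝓡 m) (fun y => (t ⟨f y, a y • X y⟩).2) x =
        mvfderiv (𝓡 m) (fun y => a y • (t ⟨f y, X y⟩).2) x := hlinear.mfderiv_eq
    rw [hderiv, mvfderiv_fun_smul ha hcoord]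
    rfl
  rw [trivializationAt_self_apply] at hleibniz
  let v : EuclideanSpace ℝ (Fin n) := mfderiv (𝓡 m) (𝓡 n) f x w
  let X₀ : EuclideanSpace ℝ (Fin n) := X x
  calc mvfderiv (𝓡 m) (fun y => (t ⟨f y, a y • X y⟩).2) x w + christoffelVec g (f x) v (a x • X₀)
      = a x • (mvfderiv (𝓡 m) (fun y => (t ⟨f y, X y⟩).2) x w + christoffelVec g (f x) v X₀) +
          mvfderiv (𝓡 m) a x w • X₀ := by
        rw [hleibniz, christoffelVec_smul_right, smul_add, add_right_comm]

theorem covDerivAlong_exp_smul (g : Metric n M) (f : L → M)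
    (X : (y : L) → TangentSpace (𝓡 n) (f y)) (x : L) (w : TangentSpace (𝓡 m) x) {v : L → ℝ}
    (hv : MDifferentiableAt (𝓡 m) 𝓘(ℝ) v x)
    (hX : MDifferentiableAt (𝓡 m) (𝓡 n).tangent
      (fun y => (⟨f y, X y⟩ : TangentBundle (𝓡 n) M)) x) :
    covDerivAlong g f (fun y => Real.exp (v y) • X y) x w =
      Real.exp (v x) • (covDerivAlong g f X x w + mvfderiv (𝓡 m) v x w • X x) := by
  have hexp : MDifferentiableAt (𝓡 m) 𝓘(ℝ) (fun y => Real.exp (v y)) x :=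
    Real.differentiableAt_exp.mdifferentiableAt.comp x hv
  rw [covDerivAlong_fun_smul g f X x w hexp hX,
    mvfderiv_comp_of_hasDerivAt (Real.hasDerivAt_exp (v x)) hv, smul_add, smul_smul]
  rfl

theorem inner_covDerivAlong_exp_smul_of_inner_eq_zero (g h : Metric n M) (f : L → M)
    (X : (y : L) → TangentSpace (𝓡 n) (f y)) (x : L) (w : TangentSpace (𝓡 m) x)
    {z : TangentSpace (𝓡 n) (f x)} (hz : h.inner (f x) (X x) z = 0) {v : L → ℝ}
    (hv : MDifferentiableAt (𝓡 m) 𝓘(ℝ) v x)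
    (hX : MDifferentiableAt (𝓡 m) (𝓡 n).tangent
      (fun y => (⟨f y, X y⟩ : TangentBundle (𝓡 n) M)) x) :
    h.inner (f x) (covDerivAlong g f (fun y => Real.exp (v y) • X y) x w) z =
      Real.exp (v x) * h.inner (f x) (covDerivAlong g f X x w) z := by
  rw [covDerivAlong_exp_smul g f X x w hv hX]
  simp [hz]

theorem inner_covDerivAlong_conformalMetric (h : Metric n M) {u : M → ℝ}
    (hu : ContMDiff (𝓡 n) 𝓘(ℝ) ∞ u) (f : L → M) (X : (y : L) → TangentSpace (𝓡 n) (f y)) (x : L)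
    (w : TangentSpace (𝓡 m) x) (z : TangentSpace (𝓡 n) (f x)) :
    h.inner (f x) (covDerivAlong (conformalMetric h u hu) f X x w) z =
      h.inner (f x) (covDerivAlong h f X x w) z +
        mvfderiv (𝓡 n) u (f x) (mfderiv (𝓡 m) (𝓡 n) f x w) * h.inner (f x) (X x) z +
        mvfderiv (𝓡 n) u (f x) (X x) * h.inner (f x) (mfderiv (𝓡 m) (𝓡 n) f x w) z -
        mvfderiv (𝓡 n) u (f x) z * h.inner (f x) (mfderiv (𝓡 m) (𝓡 n) f x w) (X x) := by
  obtain ⟨dX, hinner⟩ : ∃ dX : EuclideanSpace ℝ (Fin n), ∀ k : Metric n M,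
      h.inner (f x) (covDerivAlong k f X x w) z = h.inner (f x) dX z +
        h.inner (f x) (christoffelVec k (f x) (mfderiv (𝓡 m) (𝓡 n) f x w) (X x)) z :=
    ⟨_, fun _ => congrArg (fun A => A z) (map_add (h.inner (f x)) _ _)⟩
  rw [hinner, hinner]
  linear_combination inner_christoffelVec_conformalMetric h hu (f x)
    (mfderiv (𝓡 m) (𝓡 n) f x w) (X x) z

end CovariantDerivative

section SpinorAlgebra

variable {V : Type*} [AddCommGroup V] [Module ℝ V]

theorem matAct_add (A : Matrix (Fin 2) (Fin 2) ℂ) (ψ χ : Fin 2 → V × V) :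
    matAct A (ψ + χ) = matAct A ψ + matAct A χ := by
  funext a
  simp only [matAct, cxSmul, Pi.add_apply, ← Finset.sum_add_distrib]
  refine Finset.sum_congr rfl fun b _ => Prod.ext ?_ ?_ <;> simp <;> module

theorem matAct_smul (A : Matrix (Fin 2) (Fin 2) ℂ) (r : ℝ) (ψ : Fin 2 → V × V) :
    matAct A (r • ψ) = r • matAct A ψ := by
  funext a
  simp only [matAct, cxSmul, Pi.smul_apply, Finset.smul_sum]
  refine Finset.sum_congr rfl fun b _ => Prod.ext ?_ ?_ <;> simp <;> module

theorem matAct_gamma_zero_gamma_zero_mul_gamma_one (ψ : Fin 2 → V × V) :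
    matAct (gamma 0) (matAct (gamma 0 * gamma 1) ψ) = -matAct (gamma 1) ψ := by
  funext a
  fin_cases a <;> simp [matAct, cxSmul, gamma, Fin.sum_univ_two]

theorem matAct_gamma_one_gamma_zero_mul_gamma_one (ψ : Fin 2 → V × V) :
    matAct (gamma 1) (matAct (gamma 0 * gamma 1) ψ) = matAct (gamma 0) ψ := by
  funext a
  fin_cases a <;> simp [matAct, cxSmul, gamma, Fin.sum_univ_two]

theorem hermitian_smul_smul (g : V → V → ℝ) (a b : ℝ)
    (hg : ∀ v w, g (a • v) (b • w) = a * b * g v w) (χ ξ : Fin 2 → V × V) :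
    hermitian g (a • χ) (b • ξ) = (a * b) • hermitian g χ ξ := by
  simp only [hermitian, Pi.smul_apply, Prod.smul_fst, Prod.smul_snd, hg, Finset.smul_sum,
    Complex.real_smul]
  refine Finset.sum_congr rfl fun i _ => ?_
  push_cast
  ring

end SpinorAlgebra

section Surface

variable {M : Type*} [TopologicalSpace M]
  [ChartedSpace (EuclideanSpace ℝ (Fin 2)) M] [IsManifold (𝓡 2) ∞ M]

theorem SpinStructure.mem_idx {h : Metric 2 M} (s : SpinStructure h) (x : M) : x ∈ s.U (s.idx x) :=
  (s.cover x).choose_spec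

theorem connectionForm_smul {h : Metric 2 M} (s : SpinStructure h) (i : s.ι) (x : M) (r : ℝ)
    (w : TangentSpace (𝓡 2) x) :
    connectionForm s i x (r • w) = r * connectionForm s i x w := by
  unfold connectionForm
  rw [covDerivAlong_smul]
  exact congrArg (fun A => A (s.e i 1 x)) (map_smul (h.inner x) r _)

theorem connectionForm_conformal {h : Metric 2 M} (s : SpinStructure h) {u : M → ℝ}
    (hu : ContMDiff (𝓡 2) 𝓘(ℝ) ∞ u) (i : s.ι) {x : M} (hx : x ∈ s.U i)
    (w : TangentSpace (𝓡 2) x) :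
    connectionForm (s.conformal u hu) i x w = connectionForm s i x w +
      mvfderiv (𝓡 2) u x (s.e i 0 x) * h.inner x w (s.e i 1 x) -
      mvfderiv (𝓡 2) u x (s.e i 1 x) * h.inner x w (s.e i 0 x) := by
  have hframe : MDifferentiableAt (𝓡 2) (𝓡 2).tangent
      (fun y => (⟨id y, s.e i 0 y⟩ : TangentBundle (𝓡 2) M)) x :=
    ((s.e_smooth i 0).contMDiffAt ((s.isOpen i).mem_nhds hx)).mdifferentiableAt (by simp)
  have horth : h.inner x (s.e i 0 x) (s.e i 1 x) = 0 := by simpa using s.orthonormal i x hx 0 1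
  have hexp : Real.exp (2 * u x) * (Real.exp (-u x) * Real.exp (-u x)) = 1 := by
    rw [← Real.exp_add, ← Real.exp_add]
    ring_nf
    exact Real.exp_zero
  have hid : mfderiv (𝓡 2) (𝓡 2) (id : M → M) x w = w := by rw [mfderiv_id]; rfl
  set k := conformalMetric h u hu
  calc connectionForm (s.conformal u hu) i x w
      = Real.exp (2 * u x) * h.inner x
          (covDerivAlong k id (fun y => Real.exp (-u y) • s.e i 0 y) x w)
          (Real.exp (-u x) • s.e i 1 x) := rfl
    _ = Real.exp (2 * u x) * (Real.exp (-u x) * (Real.exp (-u x) *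
          h.inner x (covDerivAlong k id (s.e i 0) x w) (s.e i 1 x))) := by
        rw [map_smul, smul_eq_mul]
        exact congrArg (fun r => Real.exp (2 * u x) * (Real.exp (-u x) * r))
          (inner_covDerivAlong_exp_smul_of_inner_eq_zero k h id (s.e i 0) x w horth
            (hu.neg.mdifferentiable (by simp) x) hframe)
    _ = h.inner x (covDerivAlong k id (s.e i 0) x w) (s.e i 1 x) := by
        rw [← mul_assoc (Real.exp (-u x)), ← mul_assoc, hexp, one_mul]
    _ = _ := by
        have hlevi := inner_covDerivAlong_conformalMetric h hu id (s.e i 0) x w (s.e i 1 x)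
        rw [hid] at hlevi
        refine hlevi.trans ?_
        simp only [id, horth, mul_zero, add_zero]
        rfl

end Surface

section DiracOperator

variable {M : Type*} [TopologicalSpace M]
  [ChartedSpace (EuclideanSpace ℝ (Fin 2)) M] [IsManifold (𝓡 2) ∞ M]
  {n : ℕ} {N : Type*} [TopologicalSpace N]
  [ChartedSpace (EuclideanSpace ℝ (Fin n)) N] [IsManifold (𝓡 n) ∞ N]

theorem twistedDeriv_smul {h : Metric 2 M} {s : SpinStructure h} {φ : M → N} (g : Metric n N)
    (ψ : VectorSpinor n s φ) (i : s.ι) (x : M) (r : ℝ) (w : TangentSpace (𝓡 2) x) :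
    twistedDeriv g ψ i x (r • w) = r • twistedDeriv g ψ i x w := by
  simp only [twistedDeriv, connectionForm_smul, covDerivAlong_smul, mul_left_comm _ r, smul_add,
    smul_smul]
  rfl

theorem covDerivAlong_comp_conformal {h : Metric 2 M} {s : SpinStructure h} {φ : M → N}
    (g : Metric n N) (ψ : VectorSpinor n s φ) {u : M → ℝ} (hu : ContMDiff (𝓡 2) 𝓘(ℝ) ∞ u)
    (i : s.ι) {x : M} (hx : x ∈ s.U i) (w : TangentSpace (𝓡 2) x) :
    (fun a => (covDerivAlong g φ (fun y => ((ψ.conformal u hu).comp i y a).1) x w,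
        covDerivAlong g φ (fun y => ((ψ.conformal u hu).comp i y a).2) x w)) =
      Real.exp (-u x / 2) • ((fun a => (covDerivAlong g φ (fun y => (ψ.comp i y a).1) x w,
        covDerivAlong g φ (fun y => (ψ.comp i y a).2) x w)) -
        (mvfderiv (𝓡 2) u x w / 2) • ψ.comp i x) := by
  have hhalf : HasDerivAt (fun t : ℝ => -t / 2) (-1 / 2) (u x) :=
    (hasDerivAt_id (u x)).fun_neg.div_const 2
  have hderiv : mvfderiv (𝓡 2) (fun y => -u y / 2) x w = -(mvfderiv (𝓡 2) u x w / 2) := by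
    rw [mvfderiv_comp_of_hasDerivAt hhalf (hu.mdifferentiable (by simp) x), smul_apply, smul_eq_mul]
    ring
  have hfield {X : (y : M) → TangentSpace (𝓡 n) (φ y)} (hX : ContMDiffOn (𝓡 2) (𝓡 n).tangent ∞
      (fun y => (⟨φ y, X y⟩ : TangentBundle (𝓡 n) N)) (s.U i)) :
      covDerivAlong g φ (fun y => Real.exp (-u y / 2) • X y) x w = Real.exp (-u x / 2) •
        (covDerivAlong g φ X x w - (mvfderiv (𝓡 2) u x w / 2) • X x) := by
    rw [covDerivAlong_exp_smul g φ X x w ((hu.neg.div_const 2).mdifferentiable (by simp) x)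
      ((hX.contMDiffAt ((s.isOpen i).mem_nhds hx)).mdifferentiableAt (by simp)), hderiv, neg_smul,
      ← sub_eq_add_neg]
  exact funext fun a => Prod.ext (hfield (ψ.smooth_re i a)) (hfield (ψ.smooth_im i a))

theorem twistedDeriv_conformal {h : Metric 2 M} {s : SpinStructure h} {φ : M → N} (g : Metric n N)
    (ψ : VectorSpinor n s φ) {u : M → ℝ} (hu : ContMDiff (𝓡 2) 𝓘(ℝ) ∞ u) (i : s.ι) {x : M}
    (hx : x ∈ s.U i) (w : TangentSpace (𝓡 2) x) :
    twistedDeriv g (ψ.conformal u hu) i x w = Real.exp (-u x / 2) • (twistedDeriv g ψ i x w -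
      (mvfderiv (𝓡 2) u x w / 2) • ψ.comp i x +
      ((mvfderiv (𝓡 2) u x (s.e i 0 x) * h.inner x w (s.e i 1 x) -
        mvfderiv (𝓡 2) u x (s.e i 1 x) * h.inner x w (s.e i 0 x)) / 2) •
        matAct (gamma 0 * gamma 1) (ψ.comp i x)) := by
  calc twistedDeriv g (ψ.conformal u hu) i x w
      = Real.exp (-u x / 2) • ((fun a => (covDerivAlong g φ (fun y => (ψ.comp i y a).1) x w,
            covDerivAlong g φ (fun y => (ψ.comp i y a).2) x w)) -
            (mvfderiv (𝓡 2) u x w / 2) • ψ.comp i x) +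
          ((1 / 2) * connectionForm (s.conformal u hu) i x w) •
            matAct (gamma 0 * gamma 1) (Real.exp (-u x / 2) • ψ.comp i x) :=
        congrArg (· + _) (covDerivAlong_comp_conformal g ψ hu i hx w)
    _ = _ := by
        rw [connectionForm_conformal s hu i hx, matAct_smul, twistedDeriv]
        module

theorem twistedDeriv_conformal_frame_zero {h : Metric 2 M} {s : SpinStructure h} {φ : M → N}
    (g : Metric n N) (ψ : VectorSpinor n s φ) {u : M → ℝ} (hu : ContMDiff (𝓡 2) 𝓘(ℝ) ∞ u)
    (i : s.ι) {x : M} (hx : x ∈ s.U i) :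
    twistedDeriv g (ψ.conformal u hu) i x (s.e i 0 x) =
      Real.exp (-u x / 2) • (twistedDeriv g ψ i x (s.e i 0 x) -
        (mvfderiv (𝓡 2) u x (s.e i 0 x) / 2) • ψ.comp i x -
        (mvfderiv (𝓡 2) u x (s.e i 1 x) / 2) • matAct (gamma 0 * gamma 1) (ψ.comp i x)) := by
  rw [twistedDeriv_conformal g ψ hu i hx, s.orthonormal i x hx, s.orthonormal i x hx]
  simp [neg_div, ← sub_eq_add_neg]

theorem twistedDeriv_conformal_frame_one {h : Metric 2 M} {s : SpinStructure h} {φ : M → N}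
    (g : Metric n N) (ψ : VectorSpinor n s φ) {u : M → ℝ} (hu : ContMDiff (𝓡 2) 𝓘(ℝ) ∞ u)
    (i : s.ι) {x : M} (hx : x ∈ s.U i) :
    twistedDeriv g (ψ.conformal u hu) i x (s.e i 1 x) =
      Real.exp (-u x / 2) • (twistedDeriv g ψ i x (s.e i 1 x) -
        (mvfderiv (𝓡 2) u x (s.e i 1 x) / 2) • ψ.comp i x +
        (mvfderiv (𝓡 2) u x (s.e i 0 x) / 2) • matAct (gamma 0 * gamma 1) (ψ.comp i x)) := by
  rw [twistedDeriv_conformal g ψ hu i hx, s.orthonormal i x hx, s.orthonormal i x hx]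
  simp

theorem dirac_conformal {h : Metric 2 M} {s : SpinStructure h} {φ : M → N} (g : Metric n N)
    (ψ : VectorSpinor n s φ) {u : M → ℝ} (hu : ContMDiff (𝓡 2) 𝓘(ℝ) ∞ u) (i : s.ι) {x : M}
    (hx : x ∈ s.U i) :
    dirac g (ψ.conformal u hu) i x = Real.exp (-(3 / 2 * u x)) • dirac g ψ i x := by
  have hframe (a : Fin 2) :
      twistedDeriv g (ψ.conformal u hu) i x ((s.conformal u hu).e i a x) =
        Real.exp (-u x) • twistedDeriv g (ψ.conformal u hu) i x (s.e i a x) :=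
    twistedDeriv_smul g (ψ.conformal u hu) i x _ (s.e i a x)
  have hexp : Real.exp (-(3 / 2 * u x)) = Real.exp (-u x) * Real.exp (-u x / 2) := by
    rw [← Real.exp_add]
    ring_nf
  simp only [dirac, Fin.sum_univ_two, hframe, twistedDeriv_conformal_frame_zero g ψ hu i hx,
    twistedDeriv_conformal_frame_one g ψ hu i hx, sub_eq_add_neg, ← neg_smul, matAct_smul,
    matAct_add, matAct_gamma_zero_gamma_zero_mul_gamma_one,
    matAct_gamma_one_gamma_zero_mul_gamma_one, hexp]
  module

end DiracOperator

section Densities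

variable {M : Type*} [TopologicalSpace M]
  [ChartedSpace (EuclideanSpace ℝ (Fin 2)) M] [IsManifold (𝓡 2) ∞ M]
  {n : ℕ} {N : Type*} [TopologicalSpace N]
  [ChartedSpace (EuclideanSpace ℝ (Fin n)) N] [IsManifold (𝓡 n) ∞ N]

theorem dirichletDensity_conformalMetric (h : Metric 2 M) (g : Metric n N) (φ : M → N) {u : M → ℝ}
    (hu : ContMDiff (𝓡 2) 𝓘(ℝ) ∞ u) (x : M) :
    dirichletDensity (conformalMetric h u hu) g φ x =
      Real.exp (-(2 * u x)) • dirichletDensity h g φ x := by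
  simp only [dirichletDensity, inv_gram_conformalMetric, Matrix.smul_apply, smul_eq_mul,
    Finset.mul_sum, mul_assoc]

theorem diracDensity_conformal {h : Metric 2 M} {s : SpinStructure h} {φ : M → N}
    (g : Metric n N) (ψ : VectorSpinor n s φ) {u : M → ℝ} (hu : ContMDiff (𝓡 2) 𝓘(ℝ) ∞ u)
    (x : M) :
    diracDensity g (ψ.conformal u hu) x = Real.exp (-(2 * u x)) • diracDensity g ψ x := by
  have hexp : Real.exp (-(2 * u x)) = Real.exp (-u x / 2) * Real.exp (-(3 / 2 * u x)) := by
    rw [← Real.exp_add]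
    ring_nf
  calc diracDensity g (ψ.conformal u hu) x
      = hermitian (fun v w => g.inner (φ x) v w) (Real.exp (-u x / 2) • ψ.comp (s.idx x) x)
          (dirac g (ψ.conformal u hu) (s.idx x) x) := rfl
    _ = Real.exp (-(2 * u x)) • diracDensity g ψ x := by
        rw [dirac_conformal g ψ hu _ (s.mem_idx x), hermitian_smul_smul, hexp, diracDensity]
        intro v w
        simp [mul_assoc, mul_left_comm]

theorem magneticDensity_conformal {h : Metric 2 M} (s : SpinStructure h) (B : TwoForm n N)
    (φ : M → N) {u : M → ℝ} (hu : ContMDiff (𝓡 2) 𝓘(ℝ) ∞ u) (x : M) :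
    magneticDensity (s.conformal u hu) B φ x =
      Real.exp (-(2 * u x)) • magneticDensity s B φ x := by
  have hexp : Real.exp (-(2 * u x)) = Real.exp (-u x) * Real.exp (-u x) := by
    rw [← Real.exp_add]
    ring_nf
  calc magneticDensity (s.conformal u hu) B φ x
      = B.form (φ x) (mfderiv (𝓡 2) (𝓡 n) φ x (Real.exp (-u x) • s.e (s.idx x) 0 x))
          (mfderiv (𝓡 2) (𝓡 n) φ x (Real.exp (-u x) • s.e (s.idx x) 1 x)) := rfl
    _ = Real.exp (-(2 * u x)) • magneticDensity s B φ x := by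
        simp only [map_smul, smul_apply, smul_smul, ← hexp, magneticDensity]

end Densities

end MagneticDirac

end

open MagneticDirac in
theorem mainTheorem10_general
    {M : Type*} [TopologicalSpace M] [ChartedSpace (EuclideanSpace ℝ (Fin 2)) M]
    [IsManifold (𝓡 2) ∞ M] [T2Space M] [SigmaCompactSpace M] [MeasurableSpace M] [BorelSpace M]
    {n : ℕ} {N : Type*} [TopologicalSpace N] [ChartedSpace (EuclideanSpace ℝ (Fin n)) N]
    [IsManifold (𝓡 n) ∞ N]
    (h : Metric 2 M) (s : SpinStructure h) (g : Metric n N) (B : TwoForm n N)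
    (φ : M → N) (ψ : VectorSpinor n s φ) (u : M → ℝ) (hu : ContMDiff (𝓡 2) 𝓘(ℝ) ∞ u) :
    (∫ x, dirichletDensity (conformalMetric h u hu) g φ x
          ∂volumeMeasure (conformalMetric h u hu) =
        ∫ x, dirichletDensity h g φ x ∂volumeMeasure h) ∧
      (∫ x, diracDensity g (ψ.conformal u hu) x ∂volumeMeasure (conformalMetric h u hu) =
        ∫ x, diracDensity g ψ x ∂volumeMeasure h) ∧
      (∫ x, magneticDensity (s.conformal u hu) B φ x ∂volumeMeasure (conformalMetric h u hu) =
        ∫ x, magneticDensity s B φ x ∂volumeMeasure h) ∧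
      (1 / 2) * ∫ x, ((dirichletDensity (conformalMetric h u hu) g φ x : ℂ) +
          diracDensity g (ψ.conformal u hu) x + 2 * (magneticDensity (s.conformal u hu) B φ x : ℂ))
          ∂volumeMeasure (conformalMetric h u hu) =
        (1 / 2) * ∫ x, ((dirichletDensity h g φ x : ℂ) + diracDensity g ψ x +
          2 * (magneticDensity s B φ x : ℂ)) ∂volumeMeasure h := by
  refine ⟨integral_volumeMeasure_conformalMetric_of_weight h hu fun x => ?_,
    integral_volumeMeasure_conformalMetric_of_weight h hu fun x => ?_,
    integral_volumeMeasure_conformalMetric_of_weight h hu fun x => ?_,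
    congrArg _ (integral_volumeMeasure_conformalMetric_of_weight h hu fun x => ?_)⟩
  · exact dirichletDensity_conformalMetric h g φ hu x
  · exact diracDensity_conformal g ψ hu x
  · exact magneticDensity_conformal s B φ hu x
  · rw [dirichletDensity_conformalMetric, diracDensity_conformal, magneticDensity_conformal,
      Nat.cast_ofNat]
    simp only [smul_eq_mul, Complex.ofReal_mul, Complex.real_smul]
    ring

theorem mainTheorem10
    {M : Type*} [TopologicalSpace M] [ChartedSpace (EuclideanSpace ℝ (Fin 2)) M]
    [IsManifold (𝓡 2) ∞ M] [T2Space M] [CompactSpace M] [MeasurableSpace M] [BorelSpace M]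
    {n : ℕ} {N : Type*} [TopologicalSpace N] [ChartedSpace (EuclideanSpace ℝ (Fin n)) N]
    [IsManifold (𝓡 n) ∞ N] [T2Space N] [SecondCountableTopology N]
    (h : MagneticDirac.Metric 2 M) (s : MagneticDirac.SpinStructure h)
    (g : MagneticDirac.Metric n N) (B : MagneticDirac.TwoForm n N)
    (φ : M → N) (hφ : ContMDiff (𝓡 2) (𝓡 n) ∞ φ) (ψ : MagneticDirac.VectorSpinor n s φ)
    (u : M → ℝ) (hu : ContMDiff (𝓡 2) 𝓘(ℝ) ∞ u) :
    MagneticDirac.dirichletTerm (MagneticDirac.conformalMetric h u hu) g φ =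
        MagneticDirac.dirichletTerm h g φ ∧
      MagneticDirac.diracTerm g (ψ.conformal u hu) = MagneticDirac.diracTerm g ψ ∧
      MagneticDirac.magneticTerm (s.conformal u hu) B φ = MagneticDirac.magneticTerm s B φ ∧
      MagneticDirac.energy g B (ψ.conformal u hu) = MagneticDirac.energy g B ψ :=
  mainTheorem10_general h s g B φ ψ u hu
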